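/- Let $U\ge 0$ be a (finite) random variable with Laplace transform $\varphi(z)=E[e^{-zU}]$, $\operatorname{Re} z\ge 0$. A probability law on $\mathbb R$ with characteristic function $f$ is called $\varphi$-ID if there are constants $a_n>0$ and characteristic functions $f_n$ such that $f(t)=\lim_{n\to\infty}\varphi\{a_n(1-f_n(t))\}$ for all $t\in\mathbb R$. Fix integers $j\ge 0$ and $m\ge 1$ and a parameter set $\Theta\subseteq(0,\infty)$ with $0\in\overline{\Theta}$. For each $\theta\in\Theta$ let $N_\theta$ be a random variable with values in $\{0,1,2,\dots\}$ and probability generating function $P_\theta(s)=s^j\varphi\{(1-s^m)/\theta\}$, $0<s<1$. All limits below are in distribution, as $\theta\to 0$ within $\Theta$. (i) For each $\theta\in\Theta$ let $X_{\theta,1},X_{\theta,2},\dots$ be i.i.d. real random variables, the sequence being independent of $N_\theta$. Suppose that the classical sums $\sum_{i=1}^{k_\theta}X_{\theta,i}$ have a limit law for some integers $k_\theta\to\infty$. If the $N_\theta$-sums $\sum_{i=1}^{N_\theta}X_{\theta,i}$ converge to a law $\mu$, then $\mu$ is $\varphi$-ID. (ii) Conversely, let $\mu$ be $\varphi$-ID.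 Then there are laws $F_\theta$ ($\theta\in\Theta$) on $\mathbb R$ such that, whenever $X_{\theta,1},X_{\theta,2},\dots$ are i.i.d. with law $F_\theta$ and the sequence is independent of $N_\theta$, the sums $\sum_{i=1}^{N_\theta}X_{\theta,i}$ converge to $\mu$ and the classical sums $\sum_{i=1}^{\lfloor 1/\theta\rfloor}X_{\theta,i}$ also have a limit law. Such $N_\theta$ and $X_{\theta,i}$ exist for every $\theta\in\Theta$. -/

import Mathlib

open MeasureTheory ProbabilityTheory Filter Topology
open scoped NNReal

/-- The Laplace transform `φ(z) = E[exp(-zU)]` of a random variable `U ≥ 0` with law `ν`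
(a proper probability law on `[0, ∞)`); the integral converges for every complex `z` with
`0 ≤ Re z`, and `φ` is only used there. -/
noncomputable def laplaceTransform (ν : ProbabilityMeasure ℝ≥0) (z : ℂ) : ℂ :=
  ∫ u : ℝ≥0, Complex.exp (-z * ((u : ℝ) : ℂ)) ∂(ν : Measure ℝ≥0)

/-- The law `μ`, with characteristic function `f`, is `φ`-infinitely divisible, `φ` being the
Laplace transform of `ν`: there are positive constants `a n` and characteristic functions `f n`
with `f(t) = lim φ(a n * (1 - f n (t)))` for all real `t`. -/
def IsPhiID (ν : ProbabilityMeasure ℝ≥0) (μ : ProbabilityMeasure ℝ) : Prop :=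
  ∃ (a : ℕ → ℝ) (F : ℕ → ProbabilityMeasure ℝ), (∀ n, 0 < a n) ∧
    ∀ t : ℝ, Tendsto
      (fun n => laplaceTransform ν ((a n : ℂ) * (1 - charFun (F n : Measure ℝ) t)))
      atTop (𝓝 (charFun (μ : Measure ℝ) t))

/-- `N` has probability generating function `s ↦ s ^ j * φ((1 - s ^ m) / θ)`, `0 < s < 1`, where
`φ` is the Laplace transform of `ν`. -/
def HasPhiPGF (ν : ProbabilityMeasure ℝ≥0) (j m : ℕ) (θ : ℝ) {Ω : Type*} [MeasurableSpace Ω]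
    (P : ProbabilityMeasure Ω) (N : Ω → ℕ) : Prop :=
  ∀ s : ℝ, 0 < s → s < 1 →
    ((∫ ω, s ^ N ω ∂(P : Measure Ω) : ℝ) : ℂ) =
      (s : ℂ) ^ j * laplaceTransform ν ((1 - (s : ℂ) ^ m) / (θ : ℂ))

/-- The ingredients of a random sum: real random variables `X 0, X 1, …` that are i.i.d., and an
`ℕ`-valued random variable `N` that is independent of the whole sequence `X`. -/
structure IsRandomSumScheme {Ω : Type*} [MeasurableSpace Ω] (P : ProbabilityMeasure Ω)
    (N : Ω → ℕ) (X : ℕ → Ω → ℝ) : Prop where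
  measurable_N : Measurable N
  measurable_X : ∀ i, Measurable (X i)
  iIndep_X : iIndepFun X (P : Measure Ω)
  identDistrib_X : ∀ i, IdentDistrib (X i) (X 0) (P : Measure Ω) (P : Measure Ω)
  indep_N_X : IndepFun N (fun ω i => X i ω) (P : Measure Ω)

/-- The classical sum of the first `n` terms. -/
def classicalSum {Ω : Type*} (X : ℕ → Ω → ℝ) (n : ℕ) (ω : Ω) : ℝ :=
  ∑ i ∈ Finset.range n, X i ω

/-- The random sum (`N`-sum) of the first `N` terms. -/
def randomSum {Ω : Type*} (N : Ω → ℕ) (X : ℕ → Ω → ℝ) (ω : Ω) : ℝ :=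
  ∑ i ∈ Finset.range (N ω), X i ω

/-- The filter `θ → 0` on a parameter set `Θ`. -/
def thetaToZero (Θ : Set ℝ) : Filter Θ := comap ((↑) : Θ → ℝ) (𝓝 0)

/-- The random variables `S θ` (on probability spaces that may depend on `θ`) have the limit law
`μ` as `θ → 0` in `Θ`, in the sense of convergence in distribution. -/
def HasLimitLaw {Θ : Set ℝ} {Ω : Θ → Type*} [∀ θ, MeasurableSpace (Ω θ)]
    (P : ∀ θ, ProbabilityMeasure (Ω θ)) (S : ∀ θ, Ω θ → ℝ) (μ : ProbabilityMeasure ℝ) : Prop :=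
  TendstoInDistribution S (thetaToZero Θ) (id : ℝ → ℝ) (fun θ => (P θ : Measure (Ω θ)))
    (μ : Measure ℝ)

/-! ### The Laplace transform of a law on `[0, ∞)` -/

/-! The generating function identifies `N_θ` in law with `j + m K`, where `K` is Poisson with random
rate `U/θ`. Hence, if the summands have characteristic function `f_θ`, the random sum has
characteristic function `f_θ^j φ((1 - f_θ^m)/θ)`
(`IsRandomSumScheme.charFun_randomSum_of_hasPhiPGF`).

Necessity: convergence of the powers `f_θ^{k_θ}` with `k_θ → ∞` forces `f_θ → 1` pointwise
(`tendsto_charFun_one_of_pow`), so the factor `f_θ^j` drops out. Along a sequence `θ_n → 0` what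
remains is the definition of φ-ID with `a_n = 1/θ_n` and `f_n = f_{θ_n}^m`.

Converse: it suffices to write the characteristic function of `μ` as `φ(ψ)` with every `exp(-cψ)`,
`c > 0`, a characteristic function (`IsPhiID.exists_exponent`). Summands with characteristic
function `exp(-θψ/m)` then work, because `(1 - exp(-θψ))/θ → ψ`, while the classical sums tend to
`exp(-ψ/m)`.

The exponent `ψ` is a limit point of `z_n = a_n (1 - f_n)`. As `φ` need not be injective,
convergence of `φ(z_n)` does not by itself control `z_n`. But `z_n` is continuous with `z_n(0) = 0`,
and `φ` stays away from `1` on the boundary of some arbitrarily small half-squares around `0`; so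
for small `t` the path cannot leave the half-square while `φ(z_n(t))` is close to `1`. A doubling
inequality extends boundedness to all `t`, and the compound Poisson functions `exp(-c z_n)` are
tight, hence have limit laws. -/

lemma norm_exp_neg_mul_nnreal_le_one {z : ℂ} (hz : 0 ≤ z.re) (u : ℝ≥0) :
    ‖Complex.exp (-z * ((u : ℝ) : ℂ))‖ ≤ 1 := by
  rw [Complex.norm_exp]
  simp only [Complex.mul_re, Complex.neg_re, Complex.ofReal_re, Complex.ofReal_im, mul_zero,
    sub_zero, Real.exp_le_one_iff]
  nlinarith [mul_nonneg hz u.coe_nonneg]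

lemma integrable_exp_neg_mul_nnreal (ν : ProbabilityMeasure ℝ≥0) {z : ℂ} (hz : 0 ≤ z.re) :
    Integrable (fun u : ℝ≥0 => Complex.exp (-z * ((u : ℝ) : ℂ))) (ν : Measure ℝ≥0) :=
  Integrable.of_bound (by fun_prop) 1 (.of_forall (norm_exp_neg_mul_nnreal_le_one hz))

lemma continuousOn_laplaceTransform (ν : ProbabilityMeasure ℝ≥0) :
    ContinuousOn (laplaceTransform ν) {z : ℂ | 0 ≤ z.re} := by
  unfold laplaceTransform
  refine continuousOn_of_dominated (bound := fun _ => 1) (fun z _ => by fun_prop)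
    (fun z hz => .of_forall (norm_exp_neg_mul_nnreal_le_one hz)) (by simp) (.of_forall fun u => ?_)
  fun_prop

lemma tendsto_laplaceTransform {ι : Type*} {l : Filter ι} (ν : ProbabilityMeasure ℝ≥0)
    {z : ι → ℂ} {w : ℂ} (hz : ∀ᶠ i in l, 0 ≤ (z i).re) (hw : 0 ≤ w.re) (h : Tendsto z l (𝓝 w)) :
    Tendsto (fun i => laplaceTransform ν (z i)) l (𝓝 (laplaceTransform ν w)) :=
  ((continuousOn_laplaceTransform ν) w hw).tendsto.comp
    (tendsto_nhdsWithin_iff.2 ⟨h, hz⟩)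

/-- The law of the constant `c`, whose Laplace transform is `exp (-c z)`. -/
noncomputable def constLaw (c : ℝ≥0) : ProbabilityMeasure ℝ≥0 :=
  ⟨Measure.dirac c, inferInstance⟩

lemma laplaceTransform_constLaw (c : ℝ≥0) (z : ℂ) :
    laplaceTransform (constLaw c) z = Complex.exp (-z * ((c : ℝ) : ℂ)) := by
  simp [laplaceTransform, constLaw]

/-- The real part of the integrand never exceeds `1`, so a mean equal to `1` leaves no room for
smaller values. -/
lemma ae_re_exp_eq_one_of_laplaceTransform_eq_one {ν : ProbabilityMeasure ℝ≥0} {z : ℂ}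
    (hz : 0 ≤ z.re) (h : laplaceTransform ν z = 1) :
    ∀ᵐ u : ℝ≥0 ∂(ν : Measure ℝ≥0), (Complex.exp (-z * ((u : ℝ) : ℂ))).re = 1 := by
  have hint := integrable_exp_neg_mul_nnreal ν hz
  have hre : ∫ u : ℝ≥0, (Complex.exp (-z * ((u : ℝ) : ℂ))).re ∂(ν : Measure ℝ≥0) = 1 := by
    have := integral_re hint
    simp only [RCLike.re_eq_complex_re] at this
    rw [this]
    change (laplaceTransform ν z).re = 1
    simp [h]
  have hint' : Integrable (fun u : ℝ≥0 => (Complex.exp (-z * ((u : ℝ) : ℂ))).re)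
    (ν : Measure ℝ≥0) := hint.re
  have h0 : ∫ u : ℝ≥0, (1 - (Complex.exp (-z * ((u : ℝ) : ℂ))).re) ∂(ν : Measure ℝ≥0) = 0 := by
    rw [integral_sub (integrable_const _) hint', hre]; simp
  rw [integral_eq_zero_iff_of_nonneg] at h0
  · filter_upwards [h0] with u hu
    simp only [Pi.zero_apply] at hu
    linarith
  · intro u
    have := (Complex.re_le_norm _).trans (norm_exp_neg_mul_nnreal_le_one hz u)
    simpa using this
  · exact (integrable_const _).sub hint'

lemma eq_constLaw_zero_of_ae {ν : ProbabilityMeasure ℝ≥0}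
    (h : ∀ᵐ u : ℝ≥0 ∂(ν : Measure ℝ≥0), u = 0) : ν = constLaw 0 := by
  apply Subtype.ext
  have h1 : (ν : Measure ℝ≥0).map id = (ν : Measure ℝ≥0).map (fun _ => 0) := Measure.map_congr h
  rw [Measure.map_id, Measure.map_const, measure_univ, one_smul] at h1
  exact h1

lemma laplaceTransform_ne_one_of_re_pos {ν : ProbabilityMeasure ℝ≥0} (hν : ν ≠ constLaw 0) {z : ℂ}
    (hz : 0 < z.re) : laplaceTransform ν z ≠ 1 := by
  intro h
  apply hν
  apply eq_constLaw_zero_of_ae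
  filter_upwards [ae_re_exp_eq_one_of_laplaceTransform_eq_one hz.le h] with u hu
  have h1 : 1 ≤ ‖Complex.exp (-z * ((u : ℝ) : ℂ))‖ := hu ▸ Complex.re_le_norm _
  rw [Complex.norm_exp] at h1
  simp only [Complex.mul_re, Complex.neg_re, Complex.ofReal_re, Complex.ofReal_im, mul_zero,
    sub_zero, Real.one_le_exp_iff] at h1
  have h2 : (u : ℝ) ≤ 0 := by nlinarith [u.coe_nonneg]
  exact le_antisymm (by exact_mod_cast h2) (zero_le)

/-- If `U` is supported on a lattice, `φ` does return to `1` at some points of the imaginary axis.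
It cannot do so at all points arbitrarily near `0` unless `U = 0` almost surely. -/
lemma exists_laplaceTransform_mul_I_ne_one {ν : ProbabilityMeasure ℝ≥0} (hν : ν ≠ constLaw 0)
    {r : ℝ} (hr : 0 < r) :
    ∃ y : ℝ, 0 < y ∧ y ≤ r ∧ laplaceTransform ν (y * Complex.I) ≠ 1 ∧
      laplaceTransform ν (-(y * Complex.I)) ≠ 1 := by
  by_contra! hcon
  apply hν
  apply eq_constLaw_zero_of_ae
  have hcos : ∀ y : ℝ, 0 < y → y ≤ r →
      ∀ᵐ u : ℝ≥0 ∂(ν : Measure ℝ≥0), Real.cos (y * u) = 1 := by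
    intro y hy hyr
    by_cases h : laplaceTransform ν (y * Complex.I) = 1
    · filter_upwards [ae_re_exp_eq_one_of_laplaceTransform_eq_one (by simp) h] with u hu
      simpa [Complex.exp_re] using hu
    · filter_upwards [ae_re_exp_eq_one_of_laplaceTransform_eq_one (by simp)
        (hcon y hy hyr h)] with u hu
      simpa [Complex.exp_re] using hu
  have hall : ∀ᵐ u : ℝ≥0 ∂(ν : Measure ℝ≥0), ∀ n : ℕ, Real.cos (r / (n + 1) * u) = 1 := by
    rw [ae_all_iff]
    intro n
    refine hcos _ (by positivity) (div_le_self hr.le ?_)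
    have : (0 : ℝ) ≤ n := n.cast_nonneg
    linarith
  filter_upwards [hall] with u hu
  -- For this `n` the angle `r u / (n + 1)` lies in `[0, 2π)`, where the cosine equals `1` only at
  -- `0`.
  obtain ⟨n, hn⟩ := exists_nat_gt (r * u / (2 * Real.pi))
  have hpi := Real.pi_pos
  have hlt : r / (n + 1) * u < 2 * Real.pi := by
    rw [div_mul_eq_mul_div, div_lt_iff₀ (by positivity)]
    rw [div_lt_iff₀ (by positivity)] at hn
    nlinarith
  have hge : 0 ≤ r / (n + 1) * (u : ℝ) := by positivity
  have := (Real.cos_eq_one_iff_of_lt_of_lt (by linarith) hlt).1 (hu n)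
  have hne : r / ((n : ℝ) + 1) ≠ 0 := by positivity
  simpa [hne] using this

/-! ### Probability generating functions -/

lemma integrable_pow_of_norm_le_one (α : Measure ℕ) [IsProbabilityMeasure α] {z : ℂ}
    (hz : ‖z‖ ≤ 1) : Integrable (fun n => z ^ n) α :=
  Integrable.of_bound (by fun_prop) 1 (.of_forall fun n => by
    rw [norm_pow]; exact pow_le_one₀ (norm_nonneg _) hz)

/-- A probability law on `ℕ` is determined by its generating function on `(0, 1)`. -/
theorem measure_nat_eq_of_pgf_eq (α β : Measure ℕ) [IsProbabilityMeasure α]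
    [IsProbabilityMeasure β]
    (h : ∀ s : ℝ, 0 < s → s < 1 → ∫ n, s ^ n ∂α = ∫ n, s ^ n ∂β) : α = β := by
  have key (γ : Measure ℕ) [IsProbabilityMeasure γ] :
      HasFPowerSeriesOnBall (fun s : ℝ => ∑' n, γ.real {n} * s ^ n)
        (FormalMultilinearSeries.ofScalars ℝ (fun n => γ.real {n})) 0 1 := by
    have hr : 1 ≤ (FormalMultilinearSeries.ofScalars ℝ (fun n => γ.real {n})).radius := by
      have := FormalMultilinearSeries.le_radius_of_bound
        (FormalMultilinearSeries.ofScalars ℝ (fun n => γ.real {n})) (r := 1) 1 (fun n => by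
          rw [FormalMultilinearSeries.ofScalars_norm]
          simp only [NNReal.coe_one, one_pow, mul_one, Real.norm_eq_abs]
          rw [abs_of_nonneg measureReal_nonneg]
          exact measureReal_le_one)
      simpa using this
    have hb := (FormalMultilinearSeries.hasFPowerSeriesOnBall _
      (zero_lt_one.trans_le hr)).mono zero_lt_one hr
    refine hb.congr ?_
    intro s _
    simp [FormalMultilinearSeries.sum, mul_comm]
  have hsum (γ : Measure ℕ) [IsProbabilityMeasure γ] (s : ℝ) (h0 : 0 < s) (h1 : s < 1) :
      ∫ n, s ^ n ∂γ = ∑' n, γ.real {n} * s ^ n := by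
    rw [integral_countable]
    · simp
    · exact Integrable.of_bound (by fun_prop) 1 (.of_forall fun n => by
        rw [norm_pow]; exact pow_le_one₀ (norm_nonneg _) (by
          rw [Real.norm_eq_abs, abs_of_pos h0]; exact h1.le))
  -- The identity theorem needs agreement only at points accumulating at the centre `0`, so
  -- one-sided agreement on `(0, 1)` is enough.
  have hev := ((key α).analyticAt.frequently_eq_iff_eventually_eq (key β).analyticAt).1 (by
    have h2 : ∃ᶠ s in 𝓝[>] (0 : ℝ), ∑' n, α.real {n} * s ^ n = ∑' n, β.real {n} * s ^ n := by
      apply Eventually.frequently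
      filter_upwards [Ioo_mem_nhdsGT (zero_lt_one (α := ℝ))] with s hs
      rw [← hsum α s hs.1 hs.2, ← hsum β s hs.1 hs.2, h s hs.1 hs.2]
    exact h2.filter_mono (nhdsWithin_mono _ (fun x hx => ne_of_gt hx)))
  have heq := (key α).hasFPowerSeriesAt.eq_formalMultilinearSeries
    ((key β).hasFPowerSeriesAt.congr (hev.mono fun _ h => h.symm))
  have hcoef := FormalMultilinearSeries.ofScalars_series_injective ℝ ℝ heq
  refine Measure.ext_of_singleton fun n => ?_
  have := congrFun hcoef n
  simpa [measureReal_def, ENNReal.toReal_eq_toReal_iff'] using this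

/-! ### Mixed Poisson laws -/

lemma measurable_poissonMeasure : Measurable poissonMeasure := by
  refine Measure.measurable_of_measurable_coe _ fun s _ => ?_
  simp only [poissonMeasure, Measure.sum_apply_of_countable, Measure.smul_apply]
  fun_prop

lemma integral_pow_poissonMeasure (r : ℝ≥0) (z : ℂ) :
    ∫ n, z ^ n ∂(poissonMeasure r) = Complex.exp (-(1 - z) * ((r : ℝ) : ℂ)) := by
  rw [integral_poissonMeasure]
  calc ∑' n : ℕ, (Real.exp (-r) * (r : ℝ) ^ n / (n.factorial : ℝ)) • z ^ n
      = ∑' n : ℕ, ((Real.exp (-r) : ℝ) : ℂ) * ((((r : ℝ) : ℂ) * z) ^ n / n.factorial) := by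
        congr with n
        rw [Complex.real_smul]
        push_cast
        rw [mul_pow]; ring
    _ = Complex.exp (-(1 - z) * ((r : ℝ) : ℂ)) := by
        rw [tsum_mul_left, (NormedSpace.expSeries_div_hasSum_exp (((r : ℝ) : ℂ) * z)).tsum_eq,
          ← Complex.exp_eq_exp_ℂ, Complex.ofReal_exp, ← Complex.exp_add]
        push_cast
        ring_nf

/-- The kernel `u ↦ Poisson (c * u)`. -/
noncomputable def poissonRateKernel (c : ℝ≥0) : Kernel ℝ≥0 ℕ :=
  ⟨fun u => poissonMeasure (c * u), measurable_poissonMeasure.comp (by fun_prop)⟩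

instance (c : ℝ≥0) : IsMarkovKernel (poissonRateKernel c) :=
  ⟨fun u => inferInstanceAs (IsProbabilityMeasure (poissonMeasure (c * u)))⟩

/-- The Poisson law with random rate `c * U`, where `U` has law `ν`. -/
noncomputable def mixedPoisson (ν : ProbabilityMeasure ℝ≥0) (c : ℝ≥0) : Measure ℕ :=
  ((ν : Measure ℝ≥0) ⊗ₘ poissonRateKernel c).snd

instance (ν : ProbabilityMeasure ℝ≥0) (c : ℝ≥0) : IsProbabilityMeasure (mixedPoisson ν c) := by
  unfold mixedPoisson; infer_instance

lemma integral_pow_mixedPoisson (ν : ProbabilityMeasure ℝ≥0) (c : ℝ≥0) {z : ℂ} (hz : ‖z‖ ≤ 1) :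
    ∫ n, z ^ n ∂(mixedPoisson ν c) = laplaceTransform ν (((c : ℝ) : ℂ) * (1 - z)) := by
  have hint := integrable_pow_of_norm_le_one (mixedPoisson ν c) hz
  unfold mixedPoisson at hint ⊢
  rw [Measure.snd] at hint ⊢
  rw [integrable_map_measure .of_discrete (by fun_prop)] at hint
  rw [integral_map (by fun_prop) .of_discrete]
  erw [Measure.integral_compProd hint]
  refine integral_congr_ae (.of_forall fun u => ?_)
  change ∫ n, z ^ n ∂(poissonMeasure (c * u)) = _
  rw [integral_pow_poissonMeasure]
  push_cast
  ring_nf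

/-- The law of `j + m * K`, where `K` is mixed Poisson. -/
noncomputable def countLaw (ν : ProbabilityMeasure ℝ≥0) (j m : ℕ) (c : ℝ≥0) : Measure ℕ :=
  (mixedPoisson ν c).map (fun k => j + m * k)

instance (ν : ProbabilityMeasure ℝ≥0) (j m : ℕ) (c : ℝ≥0) :
    IsProbabilityMeasure (countLaw ν j m c) :=
  Measure.isProbabilityMeasure_map .of_discrete

lemma integral_pow_countLaw (ν : ProbabilityMeasure ℝ≥0) (j m : ℕ) (c : ℝ≥0) {z : ℂ}
    (hz : ‖z‖ ≤ 1) :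
    ∫ n, z ^ n ∂(countLaw ν j m c) =
      z ^ j * laplaceTransform ν (((c : ℝ) : ℂ) * (1 - z ^ m)) := by
  rw [countLaw, integral_map .of_discrete .of_discrete]
  simp_rw [pow_add, pow_mul]
  rw [integral_const_mul, integral_pow_mixedPoisson]
  rw [norm_pow]
  exact pow_le_one₀ (norm_nonneg _) hz

lemma hasPhiPGF_of_map_eq_countLaw {ν : ProbabilityMeasure ℝ≥0} {j m : ℕ} {θ : ℝ} (hθ : 0 < θ)
    {Ω : Type*} [MeasurableSpace Ω] {P : ProbabilityMeasure Ω} {N : Ω → ℕ} (hN : Measurable N)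
    (h : (P : Measure Ω).map N = countLaw ν j m (1 / θ).toNNReal) : HasPhiPGF ν j m θ P N := by
  intro s h0 h1
  have h2 := integral_pow_countLaw ν j m (1 / θ).toNNReal (z := (s : ℂ))
    (by rw [Complex.norm_real, Real.norm_eq_abs, abs_of_pos h0]; exact h1.le)
  rw [← h, integral_map hN.aemeasurable .of_discrete,
    Real.coe_toNNReal _ (by positivity)] at h2
  rw [← integral_complex_ofReal]
  push_cast at h2 ⊢
  rw [h2]
  congr 2
  ring

/-- The hypothesis concerns only real `s` in `(0, 1)`, whereas characteristic functions take complex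
values. Identifying the whole law of `N` extends the formula to the closed unit disc. -/
lemma map_eq_countLaw_of_hasPhiPGF {ν : ProbabilityMeasure ℝ≥0} {j m : ℕ} {θ : ℝ} (hθ : 0 < θ)
    {Ω : Type*} [MeasurableSpace Ω] {P : ProbabilityMeasure Ω} {N : Ω → ℕ} (hN : Measurable N)
    (h : HasPhiPGF ν j m θ P N) : (P : Measure Ω).map N = countLaw ν j m (1 / θ).toNNReal := by
  have : IsProbabilityMeasure ((P : Measure Ω).map N) :=
    Measure.isProbabilityMeasure_map hN.aemeasurable
  refine measure_nat_eq_of_pgf_eq _ _ fun s h0 h1 => ?_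
  have h2 := integral_pow_countLaw ν j m (1 / θ).toNNReal (z := (s : ℂ))
    (by rw [Complex.norm_real, Real.norm_eq_abs, abs_of_pos h0]; exact h1.le)
  rw [integral_map hN.aemeasurable .of_discrete]
  apply Complex.ofReal_injective
  rw [h s h0 h1, ← integral_complex_ofReal]
  push_cast
  rw [h2, Real.coe_toNNReal _ (by positivity)]
  push_cast
  congr 2
  ring

/-! ### Random sums -/

section RandomSum

variable {Ω : Type*} [MeasurableSpace Ω] {P : ProbabilityMeasure Ω} {N : Ω → ℕ} {X : ℕ → Ω → ℝ}

lemma IsRandomSumScheme.measurable_classicalSum (h : IsRandomSumScheme P N X) (n : ℕ) :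
    Measurable (classicalSum X n) := by
  have := h.measurable_X
  unfold classicalSum
  fun_prop

lemma IsRandomSumScheme.measurable_randomSum (h : IsRandomSumScheme P N X) :
    Measurable (randomSum N X) := by
  have h1 : Measurable (fun p : ℕ × Ω => classicalSum X p.1 p.2) :=
    measurable_from_prod_countable_right fun n => h.measurable_classicalSum n
  exact h1.comp (h.measurable_N.prodMk measurable_id)

lemma IsRandomSumScheme.charFun_classicalSum (h : IsRandomSumScheme P N X) (n : ℕ) (t : ℝ) :
    charFun ((P : Measure Ω).map (classicalSum X n)) t =
      charFun ((P : Measure Ω).map (X 0)) t ^ n := by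
  unfold classicalSum
  rw [iIndepFun.charFun_map_fun_finsetSum_eq_prod (fun i _ => (h.measurable_X i).aemeasurable)
    (h.iIndep_X.restrict _), Finset.prod_apply]
  simp [fun i => (h.identDistrib_X i).map_eq]

lemma IsRandomSumScheme.charFun_randomSum (h : IsRandomSumScheme P N X) (t : ℝ) :
    charFun ((P : Measure Ω).map (randomSum N X)) t =
      ∫ n, charFun ((P : Measure Ω).map (X 0)) t ^ n ∂((P : Measure Ω).map N) := by
  have hX : Measurable (fun ω i => X i ω) := measurable_pi_lambda _ h.measurable_X
  have hNm : IsProbabilityMeasure ((P : Measure Ω).map N) :=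
    Measure.isProbabilityMeasure_map h.measurable_N.aemeasurable
  have hXm : IsProbabilityMeasure ((P : Measure Ω).map (fun ω i => X i ω)) :=
    Measure.isProbabilityMeasure_map hX.aemeasurable
  have hS : Measurable (fun p : ℕ × (ℕ → ℝ) => ∑ i ∈ Finset.range p.1, p.2 i) :=
    measurable_from_prod_countable_right fun n =>
      show Measurable fun x : ℕ → ℝ => ∑ i ∈ Finset.range n, x i from
        Finset.measurable_fun_sum _ fun i _ => measurable_pi_apply i
  have hmap := (indepFun_iff_map_prod_eq_prod_map_map h.measurable_N.aemeasurable
    hX.aemeasurable).1 h.indep_N_X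
  have hE : Measurable (fun p : ℕ × (ℕ → ℝ) =>
      Complex.exp (t * (∑ i ∈ Finset.range p.1, p.2 i : ℝ) * Complex.I)) := by fun_prop
  calc charFun ((P : Measure Ω).map (randomSum N X)) t
      = ∫ ω, Complex.exp (t * (∑ i ∈ Finset.range (N ω), X i ω : ℝ) * Complex.I) ∂P := by
        rw [charFun_apply_real, integral_map h.measurable_randomSum.aemeasurable (by fun_prop)]
        rfl
    _ = ∫ p, Complex.exp (t * (∑ i ∈ Finset.range p.1, p.2 i : ℝ) * Complex.I)
          ∂((P : Measure Ω).map (fun ω => (N ω, fun i => X i ω))) := by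
        rw [integral_map (h.measurable_N.prodMk hX).aemeasurable hE.aestronglyMeasurable]
    _ = ∫ n, ∫ x, Complex.exp (t * (∑ i ∈ Finset.range n, x i : ℝ) * Complex.I)
          ∂((P : Measure Ω).map (fun ω i => X i ω)) ∂((P : Measure Ω).map N) := by
        rw [hmap, integral_prod]
        refine Integrable.of_bound hE.aestronglyMeasurable 1 (.of_forall fun p => ?_)
        rw [← Complex.ofReal_mul, Complex.norm_exp_ofReal_mul_I]
    _ = _ := by
        congr with n
        rw [← h.charFun_classicalSum n t, charFun_apply_real,
          integral_map (h.measurable_classicalSum n).aemeasurable (by fun_prop),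
          integral_map hX.aemeasurable (Measurable.aestronglyMeasurable (by fun_prop))]
        rfl

lemma IsRandomSumScheme.charFun_randomSum_of_hasPhiPGF (h : IsRandomSumScheme P N X)
    {ν : ProbabilityMeasure ℝ≥0} {j m : ℕ} {θ : ℝ} (hθ : 0 < θ) (hN : HasPhiPGF ν j m θ P N)
    (t : ℝ) :
    charFun ((P : Measure Ω).map (randomSum N X)) t =
      charFun ((P : Measure Ω).map (X 0)) t ^ j *
        laplaceTransform ν (((1 / θ : ℝ) : ℂ) * (1 - charFun ((P : Measure Ω).map (X 0)) t ^ m)) := by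
  have := Measure.isProbabilityMeasure_map (μ := (P : Measure Ω)) (h.measurable_X 0).aemeasurable
  rw [h.charFun_randomSum, map_eq_countLaw_of_hasPhiPGF hθ h.measurable_N hN,
    integral_pow_countLaw _ _ _ _ (norm_charFun_le_one t), Real.coe_toNNReal _ (by positivity)]

end RandomSum

/-- Random sums with prescribed summands and `φ`-generating function exist. -/
theorem exists_isRandomSumScheme (ν : ProbabilityMeasure ℝ≥0) (j m : ℕ) {θ : ℝ} (hθ : 0 < θ)
    (F : ProbabilityMeasure ℝ) :
    ∃ (Ω : Type) (_ : MeasurableSpace Ω) (P : ProbabilityMeasure Ω) (N : Ω → ℕ) (X : ℕ → Ω → ℝ),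
      IsRandomSumScheme P N X ∧ HasPhiPGF ν j m θ P N ∧
        HasLaw (X 0) (F : Measure ℝ) (P : Measure Ω) := by
  obtain ⟨Ω, _, Q, X, hXm, hXlaw, hXind, hQ⟩ := exists_iid ℕ (F : Measure ℝ)
  let α : Measure ℕ := countLaw ν j m (1 / θ).toNNReal
  let P : ProbabilityMeasure (ℕ × Ω) := ⟨α.prod Q, inferInstance⟩
  have hsnd : MeasurePreserving (Prod.snd : ℕ × Ω → Ω) (P : Measure (ℕ × Ω)) Q :=
    measurePreserving_snd
  have hlaw (i : ℕ) : HasLaw (fun p : ℕ × Ω => X i p.2) (F : Measure ℝ) (P : Measure (ℕ × Ω)) :=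
    (hXlaw i).comp hsnd.hasLaw
  refine ⟨ℕ × Ω, inferInstance, P, Prod.fst, fun i p => X i p.2, ⟨measurable_fst,
    fun i => (hXm i).comp measurable_snd, ?_, fun i => (hlaw i).identDistrib (hlaw 0), ?_⟩, ?_,
    hlaw 0⟩
  · rw [iIndepFun_iff_map_fun_eq_infinitePi_map (by fun_prop)] at hXind ⊢
    have h1 : (P : Measure (ℕ × Ω)).map (fun p i => X i p.2) = Q.map (fun ω i => X i ω) := by
      rw [← hsnd.map_eq, Measure.map_map (measurable_pi_lambda _ hXm) measurable_snd]
      rfl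
    rw [h1, hXind]
    congr with i : 1
    rw [(hlaw i).map_eq, (hXlaw i).map_eq]
  · exact indepFun_prod measurable_id (measurable_pi_lambda _ hXm)
  · exact hasPhiPGF_of_map_eq_countLaw hθ measurable_fst measurePreserving_fst.map_eq

/-- For a law `F` with characteristic function `f`, the function `φ (a (1 - f))` is a
characteristic function. -/
theorem exists_charFun_eq_laplaceTransform (ν : ProbabilityMeasure ℝ≥0) {a : ℝ} (ha : 0 < a)
    (F : ProbabilityMeasure ℝ) :
    ∃ M : ProbabilityMeasure ℝ, ∀ t, charFun (M : Measure ℝ) t =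
      laplaceTransform ν ((a : ℂ) * (1 - charFun (F : Measure ℝ) t)) := by
  -- With `j = 0`, `m = 1` and `θ = 1/a`, the random-sum formula is exactly `φ(a(1 - f))`.
  obtain ⟨Ω, _, P, N, X, h, hN, hX⟩ :=
    exists_isRandomSumScheme ν 0 1 (θ := 1 / a) (by positivity) F
  refine ⟨⟨(P : Measure Ω).map (randomSum N X),
    Measure.isProbabilityMeasure_map h.measurable_randomSum.aemeasurable⟩, fun t => ?_⟩
  have := h.charFun_randomSum_of_hasPhiPGF (by positivity) hN t
  simpa [hX.map_eq] using this

/-! ### Characteristic functions near the origin -/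

lemma tendsto_charFun_of_tendsto {ι : Type*} {l : Filter ι} {M : ι → ProbabilityMeasure ℝ}
    {Q : ProbabilityMeasure ℝ} (h : Tendsto M l (𝓝 Q)) (t : ℝ) :
    Tendsto (fun i => charFun (M i : Measure ℝ) t) l (𝓝 (charFun (Q : Measure ℝ) t)) := by
  rw [ProbabilityMeasure.tendsto_iff_forall_integral_rclike_tendsto ℂ] at h
  simp_rw [charFun_eq_integral_innerProbChar]
  exact h (BoundedContinuousFunction.innerProbChar t)

lemma norm_one_sub_exp_le (t x : ℝ) :
    ‖1 - Complex.exp (t * x * Complex.I)‖ ≤ min 2 (|t| * |x|) := by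
  refine le_min ?_ ?_
  · refine (norm_sub_le _ _).trans ?_
    rw [← Complex.ofReal_mul, Complex.norm_exp_ofReal_mul_I, norm_one]
    norm_num
  · have := Real.norm_exp_I_mul_ofReal_sub_one_le (x := t * x)
    rw [norm_sub_rev, ← Complex.ofReal_mul, mul_comm _ Complex.I, ← abs_mul]
    exact this

lemma integrable_exp_mul_I (Q : ProbabilityMeasure ℝ) (t : ℝ) :
    Integrable (fun x : ℝ => Complex.exp (t * x * Complex.I)) (Q : Measure ℝ) :=
  Integrable.of_bound (by fun_prop) 1 (.of_forall fun x => by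
    rw [← Complex.ofReal_mul, Complex.norm_exp_ofReal_mul_I])

lemma one_sub_charFun (Q : ProbabilityMeasure ℝ) (t : ℝ) :
    1 - charFun (Q : Measure ℝ) t =
      ∫ x : ℝ, (1 - Complex.exp (t * x * Complex.I)) ∂(Q : Measure ℝ) := by
  rw [integral_sub (integrable_const _) (integrable_exp_mul_I Q t), charFun_apply_real]
  simp

/-- The bounded continuous function `x ↦ min 2 (|d| * |x|)`. -/
noncomputable def truncAbs (d : ℝ) : BoundedContinuousFunction ℝ ℝ :=
  BoundedContinuousFunction.ofNormedAddCommGroup (fun x => min 2 (|d| * |x|)) (by fun_prop) 2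
    (fun x => by
      rw [Real.norm_eq_abs, abs_of_nonneg (by positivity)]
      exact min_le_left _ _)

/-- Weak convergence makes characteristic functions uniformly close to `1` near the origin. -/
theorem exists_norm_one_sub_charFun_le {ι : Type*} {l : Filter ι} {M : ι → ProbabilityMeasure ℝ}
    {Q : ProbabilityMeasure ℝ} (h : Tendsto M l (𝓝 Q)) {ε : ℝ} (hε : 0 < ε) :
    ∃ δ > 0, ∀ᶠ i in l, ∀ t : ℝ, |t| ≤ δ → ‖1 - charFun (M i : Measure ℝ) t‖ ≤ ε := by
  have h0 : Tendsto (fun d : ℝ => ∫ x, truncAbs d x ∂(Q : Measure ℝ)) (𝓝[>] 0) (𝓝 0) := by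
    have : Tendsto (fun d : ℝ => ∫ x, truncAbs d x ∂(Q : Measure ℝ)) (𝓝[>] 0)
        (𝓝 (∫ x : ℝ, (0 : ℝ) ∂(Q : Measure ℝ))) := by
      refine tendsto_integral_filter_of_dominated_convergence (fun _ => 2)
        (.of_forall fun d => (truncAbs d).continuous.aestronglyMeasurable)
        (.of_forall fun d => .of_forall fun x => ?_) (integrable_const _)
        (.of_forall fun x => ?_)
      · change ‖min 2 (|d| * |x|)‖ ≤ 2
        rw [Real.norm_eq_abs, abs_of_nonneg (by positivity)]
        exact min_le_left _ _
      · have hc : Continuous (fun d : ℝ => min 2 (|d| * |x|)) := by fun_prop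
        have := (hc.tendsto 0).mono_left (nhdsWithin_le_nhds (s := Set.Ioi 0))
        simp only [abs_zero, zero_mul, zero_le_two, inf_of_le_right] at this
        exact this
    simpa using this
  obtain ⟨δ, hδε, hδ⟩ := ((h0.eventually_lt_const hε).and self_mem_nhdsWithin).exists
  refine ⟨δ, hδ, ?_⟩
  have h1 := (ProbabilityMeasure.tendsto_iff_forall_integral_tendsto.1 h) (truncAbs δ)
  filter_upwards [h1.eventually_lt_const hδε] with i hi t ht
  rw [one_sub_charFun]
  refine (norm_integral_le_of_norm_le ((truncAbs δ).integrable _)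
    (.of_forall fun x => ?_)).trans hi.le
  refine (norm_one_sub_exp_le t x).trans ?_
  change _ ≤ min 2 (|δ| * |x|)
  rw [abs_of_pos (show 0 < δ from hδ)]
  gcongr

/-- For `|w| = 1` one has `2(1 - w) - (1 - w²) = (1 - w)²` and `|1 - w|² = 2 Re(1 - w)`. Integrating
with `w = exp(itx)` gives the constant `4 = 2 + 2`. -/
lemma norm_one_sub_charFun_two_mul_le (Q : ProbabilityMeasure ℝ) (t : ℝ) :
    ‖1 - charFun (Q : Measure ℝ) (2 * t)‖ ≤ 4 * ‖1 - charFun (Q : Measure ℝ) t‖ := by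
  have hi (s : ℝ) : Integrable (fun x : ℝ => 1 - Complex.exp (s * x * Complex.I)) (Q : Measure ℝ) :=
    (integrable_const (1 : ℂ)).sub (integrable_exp_mul_I Q s)
  have hsq (x : ℝ) : ‖(1 - Complex.exp (t * x * Complex.I)) ^ 2‖ =
      2 * (1 - Complex.exp (t * x * Complex.I)).re := by
    rw [norm_pow, Complex.sq_norm, Complex.normSq_apply, ← Complex.ofReal_mul]
    simp only [Complex.sub_re, Complex.one_re, Complex.exp_ofReal_mul_I_re, Complex.sub_im,
      Complex.one_im, Complex.exp_ofReal_mul_I_im]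
    nlinarith [Real.sin_sq_add_cos_sq (t * x)]
  have h1 : 2 * (1 - charFun (Q : Measure ℝ) t) - (1 - charFun (Q : Measure ℝ) (2 * t)) =
      ∫ x : ℝ, (1 - Complex.exp (t * x * Complex.I)) ^ 2 ∂(Q : Measure ℝ) := by
    rw [one_sub_charFun, one_sub_charFun, ← integral_const_mul,
      ← integral_sub ((hi t).const_mul 2) (hi (2 * t))]
    congr with x
    have : Complex.exp ((2 * t : ℝ) * x * Complex.I) = Complex.exp (t * x * Complex.I) ^ 2 := by
      rw [← Complex.exp_nat_mul]; push_cast; ring_nf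
    rw [this]; ring
  have h2 : ‖∫ x : ℝ, (1 - Complex.exp (t * x * Complex.I)) ^ 2 ∂(Q : Measure ℝ)‖ ≤
      2 * ‖1 - charFun (Q : Measure ℝ) t‖ := by
    refine (norm_integral_le_integral_norm _).trans ?_
    simp_rw [hsq]
    rw [integral_const_mul]
    have h3 := integral_re (hi t)
    simp only [RCLike.re_eq_complex_re] at h3
    rw [h3, ← one_sub_charFun]
    gcongr
    exact Complex.re_le_norm _
  have h4 : 1 - charFun (Q : Measure ℝ) (2 * t) = 2 * (1 - charFun (Q : Measure ℝ) t) -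
      ∫ x : ℝ, (1 - Complex.exp (t * x * Complex.I)) ^ 2 ∂(Q : Measure ℝ) := by
    rw [← h1]; ring
  rw [h4]
  refine (norm_sub_le _ _).trans ?_
  rw [norm_mul]
  norm_num
  linarith

/-- The factor `4^n` does not depend on the law, so bounds near the origin pass to every `t`, even
after multiplication by `a_n`. -/
lemma norm_one_sub_charFun_le_pow_mul (Q : ProbabilityMeasure ℝ) (t : ℝ) (n : ℕ) :
    ‖1 - charFun (Q : Measure ℝ) t‖ ≤ 4 ^ n * ‖1 - charFun (Q : Measure ℝ) (t / 2 ^ n)‖ := by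
  induction n with
  | zero => simp
  | succ n ih =>
    refine ih.trans ?_
    have := norm_one_sub_charFun_two_mul_le Q (t / 2 ^ (n + 1))
    rw [show 2 * (t / 2 ^ (n + 1)) = t / 2 ^ n by rw [pow_succ]; field_simp] at this
    rw [pow_succ, mul_assoc]
    gcongr

lemma exists_abs_div_two_pow_le (t : ℝ) {δ : ℝ} (hδ : 0 < δ) : ∃ n : ℕ, |t / 2 ^ n| ≤ δ := by
  obtain ⟨n, hn⟩ := pow_unbounded_of_one_lt (|t| / δ) (one_lt_two (α := ℝ))
  refine ⟨n, ?_⟩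
  rw [abs_div, abs_of_pos (by positivity : (0 : ℝ) < 2 ^ n), div_le_iff₀ (by positivity)]
  rw [div_lt_iff₀ hδ] at hn
  linarith

/-- A sequence of laws whose characteristic functions are uniformly close to `1` near the origin
converges weakly along every free ultrafilter. -/
theorem exists_tendsto_ultrafilter {M : ℕ → ProbabilityMeasure ℝ}
    (h : ∀ ε > 0, ∃ δ > 0, ∀ᶠ n in atTop, ∀ t : ℝ, |t| ≤ δ →
      ‖1 - charFun (M n : Measure ℝ) t‖ ≤ ε) (U : Ultrafilter ℕ) :
    ∃ H : ProbabilityMeasure ℝ, Tendsto M U (𝓝 H) := by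
  have htight : IsTightMeasureSet (Set.range fun n => (M n : Measure ℝ)) := by
    refine isTightMeasureSet_range_of_tendsto_limsup_measure_norm_gt ?_
    rw [ENNReal.tendsto_nhds_zero]
    intro ε hε
    obtain ⟨e, he, heε⟩ : ∃ e : ℝ, 0 < e ∧ ENNReal.ofReal e ≤ ε := by
      rcases eq_or_ne ε ⊤ with rfl | htop
      · exact ⟨1, one_pos, le_top⟩
      · exact ⟨ε.toReal, ENNReal.toReal_pos hε.ne' htop, ENNReal.ofReal_toReal_le⟩
    -- The tail beyond `r` is at most `r/2` times the norm of the integral of `1 - f` over an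
    -- interval of length `4/r`; a bound `e/2` on the integrand thus yields `e`.
    obtain ⟨δ, hδ, hn⟩ := h (e / 2) (by positivity)
    filter_upwards [eventually_ge_atTop (2 / δ)] with r hr
    have hr0 : 0 < r := lt_of_lt_of_le (by positivity) hr
    refine limsup_le_of_le (by isBoundedDefault) ?_
    filter_upwards [hn] with n hn
    refine le_trans ?_ heε
    rw [← ENNReal.ofReal_toReal (measure_ne_top (M n : Measure ℝ) {x : ℝ | r < ‖x‖})]
    refine ENNReal.ofReal_le_ofReal ?_
    refine (measureReal_abs_gt_le_integral_charFun (μ := (M n : Measure ℝ)) hr0).trans ?_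
    have h2r : 2 * r⁻¹ ≤ δ := by
      rw [div_le_iff₀ hδ] at hr
      rw [← div_eq_mul_inv, div_le_iff₀ hr0]
      linarith
    have := intervalIntegral.norm_integral_le_of_norm_le_const (a := -2 * r⁻¹) (b := 2 * r⁻¹)
      (f := fun t => 1 - charFun (M n : Measure ℝ) t) (C := e / 2) (fun t ht => by
        rw [Set.uIoc_of_le (by have : 0 < r⁻¹ := by positivity
                               linarith)] at ht
        refine hn t (abs_le.2 ⟨?_, ?_⟩)
        · linarith [ht.1]
        · linarith [ht.2])
    calc _ ≤ 2⁻¹ * r * (e / 2 * |2 * r⁻¹ - -2 * r⁻¹|) := by gcongr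
      _ = e := by
        rw [show 2 * r⁻¹ - -2 * r⁻¹ = 4 * r⁻¹ by ring, abs_of_pos (by positivity)]
        field_simp
        norm_num
  have hcomp : IsCompact (closure (Set.range M)) :=
    isCompact_closure_of_isTightMeasureSet (by
      convert htight using 1
      ext; simp)
  obtain ⟨H, -, hH⟩ := hcomp.ultrafilter_le_nhds (U.map M)
    (le_principal_iff.2 (Filter.mem_of_superset (Filter.range_mem_map) subset_closure))
  exact ⟨H, hH⟩

/-! ### The exponent of a `φ`-infinitely divisible law -/

/-- The set `max |Re z| |Im z| = q`, `Re z ≥ 0`, is compact and meets the imaginary axis only at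
`±iq`. Off the axis `φ ≠ 1` automatically, so `q` has only to avoid the bad imaginary points. -/
lemma exists_le_norm_one_sub_laplaceTransform {ν : ProbabilityMeasure ℝ≥0} (hν : ν ≠ constLaw 0)
    {r : ℝ} (hr : 0 < r) :
    ∃ q : ℝ, 0 < q ∧ q ≤ r ∧ ∃ ε > 0, ∀ z : ℂ, 0 ≤ z.re → max |z.re| |z.im| = q →
      ε ≤ ‖1 - laplaceTransform ν z‖ := by
  obtain ⟨q, hq, hqr, h1, h2⟩ := exists_laplaceTransform_mul_I_ne_one hν hr
  refine ⟨q, hq, hqr, ?_⟩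
  let K : Set ℂ := {z | 0 ≤ z.re ∧ max |z.re| |z.im| = q}
  have hK : IsCompact K := by
    refine Metric.isCompact_of_isClosed_isBounded ?_ ?_
    · refine (isClosed_le continuous_const Complex.continuous_re).inter
        (isClosed_eq ?_ continuous_const)
      exact (Complex.continuous_re.abs).max (Complex.continuous_im.abs)
    · refine isBounded_iff_forall_norm_le.2 ⟨2 * q, fun z hz => ?_⟩
      refine (Complex.norm_le_abs_re_add_abs_im z).trans ?_
      have := hz.2
      linarith [this ▸ le_max_left |z.re| |z.im|, this ▸ le_max_right |z.re| |z.im|]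
  have hKne : K.Nonempty := ⟨q * Complex.I, by simp, by simp [abs_of_pos hq, hq.le]⟩
  obtain ⟨w, hw, hmin⟩ := hK.exists_isMinOn hKne
    ((continuousOn_const (c := (1 : ℂ))).sub
      ((continuousOn_laplaceTransform ν).mono fun z (hz : z ∈ K) => hz.1)).norm
  refine ⟨‖1 - laplaceTransform ν w‖, ?_, fun z hz hzq => hmin ⟨hz, hzq⟩⟩
  refine norm_pos_iff.2 (sub_ne_zero.2 ?_)
  refine Ne.symm ?_
  rcases hw.1.lt_or_eq with hpos | h0
  · exact laplaceTransform_ne_one_of_re_pos hν hpos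
  · have him : |w.im| = q := by
      have := hw.2
      rwa [← h0, abs_zero, max_eq_right (abs_nonneg _)] at this
    rcases abs_eq hq.le |>.1 him with h | h
    · rwa [show w = q * Complex.I from Complex.ext (by simp [← h0]) (by simp [h])]
    · rwa [show w = -(q * Complex.I) from Complex.ext (by simp [← h0]) (by simp [h])]

/-- To leave the half-square, the path `z n` must cross its boundary by the intermediate value
theorem. There `φ` is at distance at least `ε` from `1`, against closeness `ε/2` near the origin. -/
lemma exists_norm_le_of_tendsto_laplaceTransform {ν : ProbabilityMeasure ℝ≥0}
    (hν : ν ≠ constLaw 0) {μ : ProbabilityMeasure ℝ} {M : ℕ → ProbabilityMeasure ℝ}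
    {z : ℕ → ℝ → ℂ} (hM : Tendsto M atTop (𝓝 μ))
    (hMz : ∀ n t, charFun (M n : Measure ℝ) t = laplaceTransform ν (z n t))
    (hz : ∀ n, Continuous (z n)) (hre : ∀ n t, 0 ≤ (z n t).re) (hz0 : ∀ n, z n 0 = 0)
    {r : ℝ} (hr : 0 < r) :
    ∃ δ > 0, ∀ᶠ n in atTop, ∀ t : ℝ, |t| ≤ δ → ‖z n t‖ ≤ r := by
  obtain ⟨q, hq, hqr, ε, hε, hfar⟩ := exists_le_norm_one_sub_laplaceTransform hν (half_pos hr)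
  obtain ⟨δ, hδ, hev⟩ := exists_norm_one_sub_charFun_le hM (half_pos hε)
  refine ⟨δ, hδ, ?_⟩
  filter_upwards [hev] with n hn t ht
  have hlt : max |(z n t).re| |(z n t).im| < q := by
    by_contra! hge
    have hc : Continuous (fun s => max |(z n s).re| |(z n s).im|) :=
      ((Complex.continuous_re.comp (hz n)).abs).max ((Complex.continuous_im.comp (hz n)).abs)
    have hiv := intermediate_value_uIcc (a := 0) (b := t) hc.continuousOn
    obtain ⟨s, hs, hsq⟩ := hiv (Set.mem_uIcc.2 (Or.inl ⟨by simpa [hz0] using hq.le, hge⟩))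
    have hsδ : |s| ≤ δ := by
      refine le_trans ?_ ht
      simpa using Set.abs_sub_left_of_mem_uIcc hs
    have h1 := hn s hsδ
    rw [hMz] at h1
    linarith [hfar (z n s) (hre n s) hsq]
  refine (Complex.norm_le_abs_re_add_abs_im _).trans ?_
  linarith [(le_max_left _ _).trans_lt hlt, (le_max_right _ _).trans_lt hlt]

lemma re_mul_one_sub_charFun_nonneg {a : ℝ} (ha : 0 ≤ a) (F : ProbabilityMeasure ℝ) (t : ℝ) :
    0 ≤ ((a : ℂ) * (1 - charFun (F : Measure ℝ) t)).re := by
  rw [Complex.re_ofReal_mul, Complex.sub_re, Complex.one_re]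
  have := (Complex.re_le_norm _).trans (norm_charFun_le_one (μ := (F : Measure ℝ)) t)
  exact mul_nonneg ha (by linarith)

/-- A `φ`-infinitely divisible law has characteristic function `φ(ψ)` for an exponent `ψ` such
that `exp (-c ψ)` is a characteristic function for every `c > 0`. -/
theorem IsPhiID.exists_exponent {ν : ProbabilityMeasure ℝ≥0} {μ : ProbabilityMeasure ℝ}
    (h : IsPhiID ν μ) :
    ∃ ψ : ℝ → ℂ, (∀ t, 0 ≤ (ψ t).re) ∧
      (∀ t, charFun (μ : Measure ℝ) t = laplaceTransform ν (ψ t)) ∧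
      ∀ c : ℝ, 0 < c → ∃ H : ProbabilityMeasure ℝ,
        ∀ t, charFun (H : Measure ℝ) t = Complex.exp (-(c * ψ t)) := by
  obtain ⟨a, F, ha, hlim⟩ := h
  -- If `U = 0` almost surely then `φ = 1`, which says nothing about `z_n`; but `μ` is the unit mass
  -- at `0` and `ψ = 0` serves.
  by_cases hν : ν = constLaw 0
  · refine ⟨fun _ => 0, by simp, fun t => ?_,
      fun c _ => ⟨⟨Measure.dirac 0, inferInstance⟩, fun t => ?_⟩⟩
    · have := hlim t
      simp only [hν, laplaceTransform_constLaw, NNReal.coe_zero, Complex.ofReal_zero, mul_zero,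
        Complex.exp_zero] at this ⊢
      exact (tendsto_nhds_unique this tendsto_const_nhds)
    · simp
  set z : ℕ → ℝ → ℂ := fun n t => (a n : ℂ) * (1 - charFun (F n : Measure ℝ) t) with hzdef
  have hre n t : 0 ≤ (z n t).re := re_mul_one_sub_charFun_nonneg (ha n).le (F n) t
  choose M hM using fun n => exists_charFun_eq_laplaceTransform ν (ha n) (F n)
  have hMμ : Tendsto M atTop (𝓝 μ) := by
    refine ProbabilityMeasure.tendsto_of_tendsto_charFun fun t => ?_
    simp_rw [hM]
    exact hlim t
  have hsmall {r : ℝ} (hr : 0 < r) :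
      ∃ δ > 0, ∀ᶠ n in atTop, ∀ t : ℝ, |t| ≤ δ → ‖z n t‖ ≤ r :=
    exists_norm_le_of_tendsto_laplaceTransform hν hMμ hM (fun n => by fun_prop) hre
      (fun n => by simp) hr
  -- One ultrafilter gives limits at all real `t`, and of all the laws below, simultaneously, with
  -- no extraction of subsequences.
  let U : Ultrafilter ℕ := Ultrafilter.of atTop
  have hU : (U : Filter ℕ) ≤ atTop := Ultrafilter.of_le _
  have hconv (t : ℝ) : ∃ w, Tendsto (fun n => z n t) U (𝓝 w) := by
    obtain ⟨δ, hδ, hev⟩ := hsmall one_pos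
    obtain ⟨k, hk⟩ := exists_abs_div_two_pow_le t hδ
    have hb : ∀ᶠ n in U, z n t ∈ Metric.closedBall (0 : ℂ) (4 ^ k) := by
      filter_upwards [hU hev] with n hn
      rw [mem_closedBall_zero_iff]
      have h1 := hn _ hk
      have h2 := norm_one_sub_charFun_le_pow_mul (F n) t k
      simp only [hzdef, norm_mul, Complex.norm_real, Real.norm_eq_abs, abs_of_pos (ha n)] at h1 ⊢
      have h3 := mul_le_mul_of_nonneg_left h2 (ha n).le
      have h4 := mul_le_mul_of_nonneg_left h1 (by positivity : (0 : ℝ) ≤ 4 ^ k)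
      linarith
    obtain ⟨w, -, hw⟩ := (isCompact_closedBall (0 : ℂ) (4 ^ k)).ultrafilter_le_nhds
      (U.map fun n => z n t) (le_principal_iff.2 hb)
    exact ⟨w, hw⟩
  choose ψ hψ using hconv
  have hψre (t : ℝ) : 0 ≤ (ψ t).re :=
    ge_of_tendsto' ((Complex.continuous_re.tendsto _).comp (hψ t)) fun n => hre n t
  refine ⟨ψ, hψre, fun t => ?_, fun c hc => ?_⟩
  · exact tendsto_nhds_unique ((hlim t).mono_left hU)
      (tendsto_laplaceTransform ν (.of_forall fun n => hre n t) (hψre t) (hψ t))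
  · choose E hE using fun n =>
      exists_charFun_eq_laplaceTransform (constLaw c.toNNReal) (ha n) (F n)
    have hE' n t : charFun (E n : Measure ℝ) t = Complex.exp (-(c * z n t)) := by
      rw [hE, laplaceTransform_constLaw, Real.coe_toNNReal _ hc.le]
      congr 1
      simp only [hzdef]
      ring
    obtain ⟨H, hH⟩ := exists_tendsto_ultrafilter (M := E) (fun ε hε => by
      -- This radius makes `|c z_n| ≤ min 1 (ε/2)`, as needed for `|exp w - 1| ≤ 2|w| ≤ ε`, which
      -- holds when `|w| ≤ 1`.
      obtain ⟨δ, hδ, hev⟩ := hsmall (r := min 1 (ε / 2) / c) (by positivity)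
      refine ⟨δ, hδ, hev.mono fun n hn t ht => ?_⟩
      have h1 : ‖-(c * z n t)‖ ≤ min 1 (ε / 2) := by
        rw [norm_neg, norm_mul, Complex.norm_real, Real.norm_eq_abs, abs_of_pos hc]
        have := hn t ht
        rw [le_div_iff₀ hc] at this
        linarith
      rw [hE', norm_sub_rev]
      refine (Complex.norm_exp_sub_one_le (h1.trans (min_le_left _ _))).trans ?_
      linarith [h1.trans (min_le_right _ _)]) U
    refine ⟨H, fun t => tendsto_nhds_unique (tendsto_charFun_of_tendsto hH t) ?_⟩
    simp_rw [hE']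
    exact (Complex.continuous_exp.tendsto _).comp ((hψ t).const_mul (c : ℂ)).neg

/-! ### Summands of a row-wise i.i.d. array are asymptotically negligible -/

/-- A continuous function with value `1` at the origin whose `k`-th power stays in a small disc
around `1` is itself within `O(1/k)` of `1`. -/
lemma norm_sub_one_le_of_pow {f : ℝ → ℂ} (hf : Continuous f) (hf0 : f 0 = 1) {k : ℕ} (hk : 0 < k)
    {δ : ℝ} (h : ∀ t : ℝ, |t| ≤ δ → ‖1 - f t ^ k‖ ≤ 1 / 2) {t : ℝ} (ht : |t| ≤ δ) :
    ‖f t - 1‖ ≤ 3 / (2 * k) := by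
  have hk1 : (1 : ℝ) ≤ k := by exact_mod_cast hk
  have hkC : (k : ℂ) ≠ 0 := by exact_mod_cast hk.ne'
  have hδ : 0 ≤ δ := (abs_nonneg t).trans ht
  have hslit {s : ℝ} (hs : |s| ≤ δ) : f s ^ k ∈ Complex.slitPlane := by
    refine Or.inl ?_
    have h1 := (Complex.re_le_norm _).trans (h s hs)
    simp only [Complex.sub_re, Complex.one_re] at h1
    linarith
  set w : ℝ → ℂ := fun s => Complex.log (f s ^ k) / k with hw
  have hexp {s : ℝ} (hs : |s| ≤ δ) : Complex.exp (w s) ^ k = f s ^ k := by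
    rw [← Complex.exp_nat_mul, hw, mul_div_cancel₀ _ hkC,
      Complex.exp_log (Complex.slitPlane_ne_zero (hslit hs))]
  -- Both `f` and `exp w` are continuous `k`-th roots of `f^k` on `[-δ, δ]`. Their quotient takes
  -- values in the finite set of `k`-th roots of unity, hence is constant.
  have hconst : f t * Complex.exp (-w t) = f 0 * Complex.exp (-w 0) := by
    have hfin : {z : ℂ | z ^ k = 1}.Finite := by
      have := (Polynomial.nthRootsFinset k (1 : ℂ)).finite_toSet
      refine this.subset fun z hz => ?_
      simpa [Polynomial.mem_nthRootsFinset hk] using hz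
    refine (convex_Icc (-δ) δ).isPreconnected.constant_of_mapsTo hfin.isDiscrete
      (f := fun s => f s * Complex.exp (-w s)) ?_ (fun s hs => ?_) (abs_le.1 ht) ⟨by linarith, hδ⟩
    · refine hf.continuousOn.mul (Complex.continuous_exp.comp_continuousOn
        (ContinuousOn.neg (ContinuousOn.div_const ?_ _)))
      exact (hf.pow k).continuousOn.clog fun s hs => hslit (abs_le.2 hs)
    · have hs' : |s| ≤ δ := abs_le.2 hs
      change (f s * Complex.exp (-w s)) ^ k = 1
      rw [mul_pow, ← hexp hs', ← mul_pow, ← Complex.exp_add, add_neg_cancel, Complex.exp_zero,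
        one_pow]
  have hft : f t = Complex.exp (w t) := by
    have h0 : w 0 = 0 := by simp [hw, hf0]
    rw [h0, hf0, neg_zero, Complex.exp_zero, mul_one, Complex.exp_neg] at hconst
    exact (mul_inv_eq_one₀ (Complex.exp_ne_zero _)).1 hconst
  -- From `|log(1 + v)| ≤ (3/2)|v|` with `|v| ≤ 1/2`, divided by `k`.
  have hwt : ‖w t‖ ≤ 3 / (4 * k) := by
    have h1 : ‖f t ^ k - 1‖ ≤ 1 / 2 := by rw [norm_sub_rev]; exact h t ht
    have h2 := Complex.norm_log_one_add_half_le_self h1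
    rw [add_sub_cancel] at h2
    rw [hw, norm_div, Complex.norm_natCast, div_le_div_iff₀ (by positivity) (by positivity)]
    nlinarith
  have hw1 : ‖w t‖ ≤ 1 := hwt.trans (by rw [div_le_one (by positivity)]; linarith)
  rw [hft]
  refine (Complex.norm_exp_sub_one_le hw1).trans
    ((mul_le_mul_of_nonneg_left hwt two_pos.le).trans_eq ?_)
  field_simp
  norm_num

theorem tendsto_charFun_one_of_pow {ι : Type*} {l : Filter ι} {F S : ι → ProbabilityMeasure ℝ}
    {k : ι → ℕ} {G : ProbabilityMeasure ℝ} (hk : Tendsto k l atTop) (hS : Tendsto S l (𝓝 G))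
    (hFS : ∀ i t, charFun (S i : Measure ℝ) t = charFun (F i : Measure ℝ) t ^ k i) (t : ℝ) :
    Tendsto (fun i => charFun (F i : Measure ℝ) t) l (𝓝 1) := by
  obtain ⟨δ, hδ, hev⟩ := exists_norm_one_sub_charFun_le hS (half_pos one_pos)
  have hnear {s : ℝ} (hs : |s| ≤ δ) :
      Tendsto (fun i => ‖1 - charFun (F i : Measure ℝ) s‖) l (𝓝 0) := by
    have hlim : Tendsto (fun i => (3 / 2 : ℝ) / (k i : ℝ)) l (𝓝 0) :=
      (tendsto_natCast_atTop_atTop.comp hk).const_div_atTop _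
    refine tendsto_of_tendsto_of_tendsto_of_le_of_le' tendsto_const_nhds hlim
      (.of_forall fun _ => norm_nonneg _) ?_
    filter_upwards [hev, hk.eventually_gt_atTop 0] with i hi hki
    rw [norm_sub_rev]
    refine (norm_sub_one_le_of_pow (by fun_prop) (by simp) hki
      (fun u hu => hFS i u ▸ hi u hu) hs).trans_eq ?_
    rw [div_div]
  obtain ⟨n, hn⟩ := exists_abs_div_two_pow_le t hδ
  rw [tendsto_iff_norm_sub_tendsto_zero]
  refine squeeze_zero (fun _ => norm_nonneg _) (fun i => ?_)
    (by simpa using (hnear hn).const_mul (4 ^ n))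
  rw [norm_sub_rev]
  exact norm_one_sub_charFun_le_pow_mul (F i) t n

/-! ### Limit laws along `θ → 0` -/

section LimitLaw

variable {Θ : Set ℝ}

lemma neBot_thetaToZero (h : (0 : ℝ) ∈ closure Θ) : (thetaToZero Θ).NeBot :=
  mem_closure_iff_comap_neBot.1 h

lemma tendsto_coe_thetaToZero : Tendsto ((↑) : Θ → ℝ) (thetaToZero Θ) (𝓝 0) :=
  tendsto_comap

instance : (thetaToZero Θ).IsCountablyGenerated := by
  unfold thetaToZero; infer_instance

lemma tendsto_coe_thetaToZero_nhdsGT (hΘ : ∀ θ ∈ Θ, 0 < θ) :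
    Tendsto ((↑) : Θ → ℝ) (thetaToZero Θ) (𝓝[>] 0) :=
  tendsto_nhdsWithin_iff.2 ⟨tendsto_coe_thetaToZero, .of_forall fun θ => hΘ θ θ.2⟩

variable {Ω : Θ → Type*} [∀ θ, MeasurableSpace (Ω θ)] {P : ∀ θ, ProbabilityMeasure (Ω θ)}
  {S : ∀ θ, Ω θ → ℝ} {μ : ProbabilityMeasure ℝ}

lemma HasLimitLaw.tendsto_map (h : HasLimitLaw P S μ) (hS : ∀ θ, AEMeasurable (S θ) (P θ)) :
    Tendsto (β := ProbabilityMeasure ℝ) (fun θ => ⟨(P θ : Measure (Ω θ)).map (S θ),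
      Measure.isProbabilityMeasure_map (hS θ)⟩) (thetaToZero Θ) (𝓝 μ) := by
  have h1 := TendstoInDistribution.tendsto h
  have hid : (⟨(μ : Measure ℝ).map id, Measure.isProbabilityMeasure_map aemeasurable_id⟩ :
      ProbabilityMeasure ℝ) = μ := Subtype.ext Measure.map_id
  exact h1.trans_eq (congrArg 𝓝 hid)

lemma hasLimitLaw_of_tendsto_charFun (hS : ∀ θ, Measurable (S θ))
    (h : ∀ t, Tendsto (fun θ => charFun ((P θ : Measure (Ω θ)).map (S θ)) t) (thetaToZero Θ)
      (𝓝 (charFun (μ : Measure ℝ) t))) : HasLimitLaw P S μ where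
  forall_aemeasurable θ := (hS θ).aemeasurable
  aemeasurable_limit := aemeasurable_id
  tendsto := by
    -- Lévy's continuity theorem is applied along sequences, which suffice because the filter is
    -- countably generated.
    refine tendsto_of_seq_tendsto fun u hu => ?_
    refine ProbabilityMeasure.tendsto_of_tendsto_charFun fun t => ?_
    simp only [ProbabilityMeasure.coe_mk, Measure.map_id]
    exact (h t).comp hu

end LimitLaw

/-! ### The two directions of the theorem -/

lemma tendsto_div_mul_one_sub_exp (ψ : ℂ) :
    Tendsto (fun θ : ℝ => ((1 / θ : ℝ) : ℂ) * (1 - Complex.exp (-(θ * ψ)))) (𝓝[>] 0) (𝓝 ψ) := by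
  have hd : HasDerivAt (fun θ : ℝ => Complex.exp (-((θ : ℂ) * ψ))) (-ψ) 0 := by
    have h1 : HasDerivAt (fun θ : ℝ => -((θ : ℂ) * ψ)) (-ψ) 0 := by
      have h := ((Complex.ofRealCLM.hasDerivAt (x := (0 : ℝ))).mul_const ψ).neg
      rw [Complex.ofRealCLM_apply, Complex.ofReal_one, one_mul] at h
      exact h
    simpa using h1.cexp
  have h2 := (hd.tendsto_slope_zero.mono_left (nhdsGT_le_nhdsNE 0)).neg
  simp only [neg_neg] at h2
  refine h2.congr fun θ => ?_
  simp only [zero_add, Complex.ofReal_zero, zero_mul, neg_zero, Complex.exp_zero,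
    Complex.real_smul]
  push_cast
  ring

lemma tendsto_floor_mul (c : ℂ) :
    Tendsto (fun θ : ℝ => (⌊1 / θ⌋₊ : ℂ) * (θ * c)) (𝓝[>] 0) (𝓝 c) := by
  have h1 : Tendsto (fun θ : ℝ => (⌊1 / θ⌋₊ : ℝ) / (1 / θ)) (𝓝[>] 0) (𝓝 1) := by
    refine (tendsto_nat_floor_div_atTop (R := ℝ)).comp ?_
    exact tendsto_inv_nhdsGT_zero.congr fun θ => (one_div θ).symm
  have h2 := ((Complex.continuous_ofReal.tendsto 1).comp h1).mul_const c
  simp only [Complex.ofReal_one, one_mul] at h2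
  refine h2.congr fun θ => ?_
  simp only [Function.comp_apply, one_div, div_inv_eq_mul]
  push_cast
  ring

theorem isPhiID_of_hasLimitLaw {ν : ProbabilityMeasure ℝ≥0} {j m : ℕ} {Θ : Set ℝ}
    (hΘ : ∀ θ ∈ Θ, 0 < θ) (hΘ0 : (0 : ℝ) ∈ closure Θ) {μ G : ProbabilityMeasure ℝ}
    {Ω : Θ → Type*} [∀ θ, MeasurableSpace (Ω θ)] {P : ∀ θ, ProbabilityMeasure (Ω θ)}
    {N : ∀ θ, Ω θ → ℕ} {X : ∀ θ, ℕ → Ω θ → ℝ} {k : Θ → ℕ}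
    (hNX : ∀ θ : Θ, IsRandomSumScheme (P θ) (N θ) (X θ))
    (hN : ∀ θ : Θ, HasPhiPGF ν j m θ (P θ) (N θ)) (hk : Tendsto k (thetaToZero Θ) atTop)
    (hG : HasLimitLaw P (fun θ => classicalSum (X θ) (k θ)) G)
    (hμ : HasLimitLaw P (fun θ => randomSum (N θ) (X θ)) μ) : IsPhiID ν μ := by
  have := neBot_thetaToZero hΘ0
  obtain ⟨u, hu⟩ := exists_seq_tendsto (thetaToZero Θ)
  let F (θ : Θ) : ProbabilityMeasure ℝ := ⟨(P θ : Measure (Ω θ)).map (X θ 0),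
    Measure.isProbabilityMeasure_map ((hNX θ).measurable_X 0).aemeasurable⟩
  -- The sum of `m` summands realises `f_θ^m` as a characteristic function, as the definition of
  -- φ-ID requires.
  let Fm (θ : Θ) : ProbabilityMeasure ℝ := ⟨(P θ : Measure (Ω θ)).map (classicalSum (X θ) m),
    Measure.isProbabilityMeasure_map ((hNX θ).measurable_classicalSum m).aemeasurable⟩
  have hF1 (t : ℝ) : Tendsto (fun θ => charFun (F θ : Measure ℝ) t) (thetaToZero Θ) (𝓝 1) :=
    tendsto_charFun_one_of_pow (F := F) hk
      (hG.tendsto_map fun θ => ((hNX θ).measurable_classicalSum _).aemeasurable)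
      (fun θ s => (hNX θ).charFun_classicalSum (k θ) s) t
  refine ⟨fun n => 1 / (u n : ℝ), fun n => Fm (u n), fun n => one_div_pos.2 (hΘ _ (u n).2),
    fun t => ?_⟩
  have h1 : Tendsto (fun θ : Θ => charFun (F θ : Measure ℝ) t ^ j *
      laplaceTransform ν (((1 / (θ : ℝ) : ℝ) : ℂ) * (1 - charFun (Fm θ : Measure ℝ) t)))
      (thetaToZero Θ) (𝓝 (charFun (μ : Measure ℝ) t)) := by
    refine (tendsto_charFun_of_tendsto
      (hμ.tendsto_map fun θ => (hNX θ).measurable_randomSum.aemeasurable) t).congr fun θ => ?_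
    exact ((hNX θ).charFun_randomSum_of_hasPhiPGF (hΘ θ θ.2) (hN θ) t).trans
      (by rw [← (hNX θ).charFun_classicalSum m t]; rfl)
  have h2 := h1.div ((hF1 t).pow j) (by simp)
  rw [one_pow, div_one] at h2
  suffices h3 : Tendsto (fun θ : Θ =>
      laplaceTransform ν (((1 / (θ : ℝ) : ℝ) : ℂ) * (1 - charFun (Fm θ : Measure ℝ) t)))
      (thetaToZero Θ) (𝓝 (charFun (μ : Measure ℝ) t)) from h3.comp hu
  refine h2.congr' ?_
  filter_upwards [(hF1 t).eventually_ne one_ne_zero] with θ hθ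
  simp only [Pi.div_apply]
  rw [mul_div_cancel_left₀ _ (pow_ne_zero _ hθ)]

theorem hasLimitLaw_of_charFun_eq_exp {ν : ProbabilityMeasure ℝ≥0} {j m : ℕ} (hm : 1 ≤ m)
    {Θ : Set ℝ} (hΘ : ∀ θ ∈ Θ, 0 < θ) {μ G : ProbabilityMeasure ℝ} {ψ : ℝ → ℂ}
    (hψ : ∀ t, 0 ≤ (ψ t).re) (hμ : ∀ t, charFun (μ : Measure ℝ) t = laplaceTransform ν (ψ t))
    (hG : ∀ t, charFun (G : Measure ℝ) t = Complex.exp (-((1 / m : ℝ) * ψ t)))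
    {F : Θ → ProbabilityMeasure ℝ}
    (hF : ∀ θ t, charFun (F θ : Measure ℝ) t = Complex.exp (-((θ / m : ℝ) * ψ t)))
    {Ω : Θ → Type*} [∀ θ, MeasurableSpace (Ω θ)] {P : ∀ θ, ProbabilityMeasure (Ω θ)}
    {N : ∀ θ, Ω θ → ℕ} {X : ∀ θ, ℕ → Ω θ → ℝ}
    (hNX : ∀ θ : Θ, IsRandomSumScheme (P θ) (N θ) (X θ))
    (hN : ∀ θ : Θ, HasPhiPGF ν j m θ (P θ) (N θ))
    (hX : ∀ θ : Θ, HasLaw (X θ 0) (F θ : Measure ℝ) (P θ : Measure (Ω θ))) :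
    HasLimitLaw P (fun θ => classicalSum (X θ) ⌊1 / (θ : ℝ)⌋₊) G ∧
      HasLimitLaw P (fun θ => randomSum (N θ) (X θ)) μ := by
  have hmC : (m : ℂ) ≠ 0 := by exact_mod_cast (by omega : m ≠ 0)
  constructor
  · refine hasLimitLaw_of_tendsto_charFun (fun θ => (hNX θ).measurable_classicalSum _) fun t => ?_
    have h1 := (Complex.continuous_exp.tendsto _).comp
      ((tendsto_floor_mul (-((1 / m : ℝ) * ψ t))).comp (tendsto_coe_thetaToZero_nhdsGT hΘ))
    rw [hG]
    refine h1.congr fun θ => ?_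
    rw [(hNX θ).charFun_classicalSum, (hX θ).map_eq, hF, ← Complex.exp_nat_mul]
    simp only [Function.comp_apply]
    push_cast
    ring_nf
  · refine hasLimitLaw_of_tendsto_charFun (fun θ => (hNX θ).measurable_randomSum) fun t => ?_
    -- The division by `m` in the exponent of `F θ` is chosen to cancel here, making the argument of
    -- `φ` a difference quotient with limit `ψ t`.
    have hpow (θ : Θ) : charFun (F θ : Measure ℝ) t ^ m = Complex.exp (-((θ : ℝ) * ψ t)) := by
      rw [hF, ← Complex.exp_nat_mul]
      congr 1
      push_cast
      field_simp
    have h1 : Tendsto (fun θ : Θ => charFun (F θ : Measure ℝ) t ^ j) (thetaToZero Θ) (𝓝 1) := by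
      have hc : Continuous (fun θ : ℝ => Complex.exp (-((θ / m : ℝ) * ψ t)) ^ j) := by fun_prop
      have := (hc.tendsto 0).comp (tendsto_coe_thetaToZero (Θ := Θ))
      simp only [zero_div, Complex.ofReal_zero, zero_mul, neg_zero, Complex.exp_zero,
        one_pow] at this
      exact this.congr fun θ => by simp only [Function.comp_apply, hF]
    have h2 := tendsto_laplaceTransform ν (l := thetaToZero Θ) (.of_forall fun θ => ?_) (hψ t)
      ((tendsto_div_mul_one_sub_exp (ψ t)).comp (tendsto_coe_thetaToZero_nhdsGT hΘ))
    · have h3 := h1.mul h2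
      rw [one_mul] at h3
      rw [hμ]
      refine h3.congr fun θ => ?_
      rw [(hNX θ).charFun_randomSum_of_hasPhiPGF (hΘ θ θ.2) (hN θ) t, (hX θ).map_eq, hpow]
      rfl
    · have hθ := hΘ θ θ.2
      simp only [Function.comp_apply]
      rw [Complex.re_ofReal_mul, Complex.sub_re, Complex.one_re, ← hpow]
      have hle : ‖charFun (F θ : Measure ℝ) t ^ m‖ ≤ 1 := by
        rw [norm_pow]; exact pow_le_one₀ (norm_nonneg _) (norm_charFun_le_one t)
      exact mul_nonneg (by positivity) (by linarith [(Complex.re_le_norm _).trans hle])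

theorem theorem2p8 (ν : ProbabilityMeasure ℝ≥0) (j m : ℕ) (hm : 1 ≤ m)
    (Θ : Set ℝ) (hΘ : ∀ θ ∈ Θ, 0 < θ) (hΘ0 : (0 : ℝ) ∈ closure Θ)
    (μ : ProbabilityMeasure ℝ) :
    -- Necessity: a limit law of random sums, whose classical sums have a limit law, is `φ`-ID.
    (∀ (Ω : Θ → Type*) [∀ θ, MeasurableSpace (Ω θ)] (P : ∀ θ, ProbabilityMeasure (Ω θ))
        (N : ∀ θ, Ω θ → ℕ) (X : ∀ θ, ℕ → Ω θ → ℝ) (k : Θ → ℕ) (G : ProbabilityMeasure ℝ),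
        (∀ θ : Θ, IsRandomSumScheme (P θ) (N θ) (X θ)) →
        (∀ θ : Θ, HasPhiPGF ν j m θ (P θ) (N θ)) →
        Tendsto k (thetaToZero Θ) atTop →
        HasLimitLaw P (fun θ => classicalSum (X θ) (k θ)) G →
        HasLimitLaw P (fun θ => randomSum (N θ) (X θ)) μ →
        IsPhiID ν μ) ∧
    -- Converse: with suitable laws `F θ` of the summands, such random sums exist, and all of them
    -- have the given `φ`-ID law as limit law, while their classical sums have a limit law.
    (IsPhiID ν μ →
      ∃ F : Θ → ProbabilityMeasure ℝ,
        (∀ θ : Θ, ∃ (Ω : Type) (_ : MeasurableSpace Ω) (P : ProbabilityMeasure Ω)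
          (N : Ω → ℕ) (X : ℕ → Ω → ℝ),
          IsRandomSumScheme P N X ∧ HasPhiPGF ν j m θ P N ∧
            HasLaw (X 0) (F θ : Measure ℝ) (P : Measure Ω)) ∧
        ∃ G : ProbabilityMeasure ℝ,
          ∀ (Ω : Θ → Type*) [∀ θ, MeasurableSpace (Ω θ)] (P : ∀ θ, ProbabilityMeasure (Ω θ))
            (N : ∀ θ, Ω θ → ℕ) (X : ∀ θ, ℕ → Ω θ → ℝ),
            (∀ θ : Θ, IsRandomSumScheme (P θ) (N θ) (X θ)) →
            (∀ θ : Θ, HasPhiPGF ν j m θ (P θ) (N θ)) →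
            (∀ θ : Θ, HasLaw (X θ 0) (F θ : Measure ℝ) (P θ : Measure (Ω θ))) →
            HasLimitLaw P (fun θ => classicalSum (X θ) ⌊1 / (θ : ℝ)⌋₊) G ∧
              HasLimitLaw P (fun θ => randomSum (N θ) (X θ)) μ) := by
  refine ⟨fun Ω _ P N X k G hNX hN hk hG hμ => isPhiID_of_hasLimitLaw hΘ hΘ0 hNX hN hk hG hμ,
    fun h => ?_⟩
  obtain ⟨ψ, hψ, hμ, hexp⟩ := h.exists_exponent
  have hm0 : (0 : ℝ) < m := by exact_mod_cast hm
  choose F hF using fun θ : Θ => hexp (θ / m) (div_pos (hΘ θ θ.2) hm0)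
  obtain ⟨G, hG⟩ := hexp (1 / m) (one_div_pos.2 hm0)
  exact ⟨F, fun θ => exists_isRandomSumScheme ν j m (hΘ θ θ.2) (F θ), G,
    fun Ω _ P N X hNX hN hX => hasLimitLaw_of_charFun_eq_exp hm hΘ hψ hμ hG hF hNX hN hX⟩
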